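/- Let $-\pi<\underline\theta<0<\overline\theta<\pi$ and $\underline d<0<\overline d$, and let \begin{align*} \overline Q_1&=\{(\theta,d):\theta\in(0,\overline\theta),\ d\in[0,\overline d)\}, & \overline Q_2&=\{(\theta,d):\theta\in(\underline\theta,0],\ d\in(0,\overline d)\},\\ \overline Q_3&=\{(\theta,d):\theta\in(\underline\theta,0),\ d\in(\underline d,0]\}, & \overline Q_4&=\{(\theta,d):\theta\in[0,\overline\theta),\ d\in(\underline d,0)\}, \end{align*} $$\overline Q_1^L=\Big\{(\theta,d)\in\overline Q_1: d\le-\tfrac{\overline d}{\overline\theta}\theta+\overline d\Big\},\qquad \overline Q_3^L=\Big\{(\theta,d)\in\overline Q_3: d\ge-\tfrac{\underline d}{\underline\theta}\theta+\underline d\Big\},$$ $$X_0=\overline Q_1^L\cup\overline Q_2\cup\overline Q_3^L\cup\overline Q_4,\qquad X=X_0\cup\overline Q_1\cup\overline Q_3 ,$$ so that $X$ is the open rectangle $R=(\underline\theta,\overline\theta)\times(\underline d,\overline d)$ without the origin. Let $F:\mathbb R^2\to\mathbb R$ be continuously differentiable on $R$ with $F(0,0)=0$ and with $\partial F/\partial\theta<0$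 and $\partial F/\partial d<0$ on $X$. Assume that the zero curve of $F$ attains in $R$ every height between $\underline d$ and $\overline d$: for every $d\in(\underline d,\overline d)$ there is $\theta\in(\underline\theta,\overline\theta)$ with $F(\theta,d)=0$. (If the zero curve is written $d=h(\theta)$ with $h$ continuous on $[\underline\theta,\overline\theta]$, this holds as soon as $h(\overline\theta)\le\underline d$ and $\overline d\le h(\underline\theta)$.) Then there exist $\alpha,\beta,\gamma>0$ such that for the system $$\dot\theta=\gamma F(\theta,d),\qquad \dot d=\beta e^{-\alpha F(\theta,d)^2}\sin\theta$$ the following hold. For every $x_0\in X_0$ there is exactly one trajectory $x(\cdot\,;x_0)$ on $[0,\infty)$ that starts at $x_0$, and $\lim_{t\to\infty}x(t;x_0)=0$. Moreover the origin is Lyapunov stable: for every $\varepsilon>0$ there is $\delta>0$ such that every trajectory $x$ on $[0,\infty)$ with $\|x(0)\|<\delta$ satisfies $\|x(t)\|<\varepsilon$ for all $t\ge0$. -/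

import Mathlib

open Set Filter Topology

namespace ScoreControl

/-! A state is a pair `p = (θ, d)`: `p.1` is the heading angle `θ`, `p.2` the offset `d`.
The numbers `θl < 0 < θu` and `dl < 0 < du` are the lower and upper bounds of `θ` and `d`. -/

/-- The closed-loop vector field `(θ, d) ↦ (γ F, β exp (-α F ^ 2) sin θ)`. -/
noncomputable def closedLoop (F : ℝ × ℝ → ℝ) (α β γ : ℝ) (p : ℝ × ℝ) : ℝ × ℝ :=
  (γ * F p, β * Real.exp (-α * F p ^ 2) * Real.sin p.1)

/-- `x` is, on `[0, ∞)`, a trajectory of the closed loop that starts at `x₀`. -/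
def IsTrajectory (F : ℝ × ℝ → ℝ) (α β γ : ℝ) (x₀ : ℝ × ℝ) (x : ℝ → ℝ × ℝ) : Prop :=
  x 0 = x₀ ∧ ∀ t ∈ Ici (0 : ℝ), HasDerivWithinAt x (closedLoop F α β γ (x t)) (Ici 0) t

/-- First quadrant, with the positive `θ` axis. -/
def Q1 (θu du : ℝ) : Set (ℝ × ℝ) := {p | p.1 ∈ Ioo 0 θu ∧ p.2 ∈ Ico 0 du}

/-- Second quadrant, with the positive `d` axis. -/
def Q2 (θl du : ℝ) : Set (ℝ × ℝ) := {p | p.1 ∈ Ioc θl 0 ∧ p.2 ∈ Ioo 0 du}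

/-- Third quadrant, with the negative `θ` axis. -/
def Q3 (θl dl : ℝ) : Set (ℝ × ℝ) := {p | p.1 ∈ Ioo θl 0 ∧ p.2 ∈ Ioc dl 0}

/-- Fourth quadrant, with the negative `d` axis. -/
def Q4 (θu dl : ℝ) : Set (ℝ × ℝ) := {p | p.1 ∈ Ico 0 θu ∧ p.2 ∈ Ioo dl 0}

/-- The part of the first quadrant on the origin's side of the segment from `(θu, 0)`
to `(0, du)`. -/
def Q1L (θu du : ℝ) : Set (ℝ × ℝ) := {p | p ∈ Q1 θu du ∧ p.2 ≤ -(du / θu) * p.1 + du}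

/-- The part of the third quadrant on the origin's side of the segment from `(θl, 0)`
to `(0, dl)`. -/
def Q3L (θl dl : ℝ) : Set (ℝ × ℝ) := {p | p ∈ Q3 θl dl ∧ -(dl / θl) * p.1 + dl ≤ p.2}

/-- The set `X₀` of initial states. -/
def X0 (θl θu dl du : ℝ) : Set (ℝ × ℝ) := Q1L θu du ∪ Q2 θl du ∪ Q3L θl dl ∪ Q4 θu dl

/-- The state set `X` (the open rectangle without the origin). -/
def X (θl θu dl du : ℝ) : Set (ℝ × ℝ) := X0 θl θu dl du ∪ Q1 θu du ∪ Q3 θl dl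

/-- `F` is a state-based score function: continuously differentiable on the open rectangle, zero at
the origin, with both partial derivatives negative on `X`. Nothing is asked of `F` elsewhere. -/
structure IsScoreFunction (F : ℝ × ℝ → ℝ) (θl θu dl du : ℝ) : Prop where
  contDiffOn : ContDiffOn ℝ 1 F (Ioo θl θu ×ˢ Ioo dl du)
  map_zero : F (0, 0) = 0
  partial_theta_neg : ∀ p ∈ X θl θu dl du, deriv (fun s => F (s, p.2)) p.1 < 0
  partial_d_neg : ∀ p ∈ X θl θu dl du, deriv (fun s => F (p.1, s)) p.2 < 0

/-- The zero curve of `F`, the graph of a decreasing function `d = h θ` with `h 0 = 0`, rises to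
the height `du` or more towards `θl` and falls to `dl` or less towards `θu`. That is
`h θu ≤ dl` and `du ≤ h θl`, said without evaluating `h` at the ends of its interval:
the curve attains each height between `dl` and `du` inside the rectangle. -/
def ZeroCurveSpans (F : ℝ × ℝ → ℝ) (θl θu dl du : ℝ) : Prop :=
  ∀ d ∈ Ioo dl du, ∃ θ ∈ Ioo θl θu, F (θ, d) = 0

end ScoreControl

/-!
The parameters are `α = γ = 1` and a small `β`.

*A Lyapunov function.* Multiplying the closed loop by `exp (F ^ 2)` changes only the time along its
trajectories and turns it into `θ' = G`, `d' = β sin θ`, where `G = F exp (F ^ 2)` is a strictly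
increasing function of `F` and so decreases in `θ` and in `d`, like `F`. Therefore
`β (1 - cos θ) - ∫₀ᵈ G (0, s) ds` is positive definite. Its derivative along the trajectories is a
positive multiple of `sin θ (G (θ, d) - G (0, d))`, which is negative for `θ ≠ 0`. A trajectory cannot stay on `θ = 0` without
being at the origin. This gives stability (`lyapunov_stable`) and, by LaSalle's principle
(`tendsto_of_lyapunov`), convergence to the origin of each trajectory that stays in a compact part
of the rectangle.

*Compact invariant sets.* An initial state in `X₀` satisfies `d / du + θ / (2 θu) < 1` and
`d / dl + θ / (2 θl) < 1`, hence both with a bound `c < 1` on the right. In the closed first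
quadrant, `F` is negative and bounded away from `0` where the first form is at least `1 / 2`, so for
small `β` the form decreases there. The bounds by `c`, together with suitable bounds on `θ` and `d`,
cut out a hexagon on whose sides the field points strictly inwards (`exists_invariant_hexagon`). The
bound on the left exists because the zero curve of `F` reaches the height of the top side, so `F` is
positive far enough to the left. The sides on the right and below come from the symmetry
`F ↦ -F (-·)`, `IsScoreFunction.reflect`.

*Existence and uniqueness.* The field is Lipschitz on a box around the hexagon. Composed with the
projection to the box it is globally Lipschitz and bounded, so it has solutions on `[0, ∞)`; these
stay in the hexagon, where both fields agree (`exists_integralCurve_mem_of_invariant`). Every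
trajectory of the original field stays in the hexagon as well, so Grönwall's estimate gives
uniqueness.
-/

namespace ScoreControl

/-! ### Ordinary differential equations on a half-line -/

section HalfLine

open scoped NNReal

variable {E : Type*} [NormedAddCommGroup E] [NormedSpace ℝ E] {v : E → E} {x y : ℝ → E}

/-- Continuous induction on `[0, ∞)`. -/
lemma forall_mem_of_eventually {Y : Type*} [TopologicalSpace Y] {x : ℝ → Y} {S : Set Y}
    (hS : IsClosed S) (hx : ContinuousOn x (Ici 0)) (h0 : x 0 ∈ S)
    (h : ∀ t, 0 ≤ t → (∀ s ∈ Icc 0 t, x s ∈ S) → ∀ᶠ s in 𝓝[>] t, x s ∈ S) :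
    ∀ t, 0 ≤ t → x t ∈ S := by
  intro T hT
  have hcl : IsClosed (x ⁻¹' S ∩ Icc 0 T) := by
    rw [inter_comm]
    exact (hx.mono Icc_subset_Ici_self).preimage_isClosed_of_isClosed isClosed_Icc hS
  exact hcl.Icc_subset_of_forall_mem_nhdsGT_of_Icc_subset h0
    (fun t ht hsub => h t ht.1 hsub) ⟨hT, le_rfl⟩

/-- A bound that a real function satisfies persists for a short time if the function decreases
whenever the bound is attained. -/
lemma eventually_le_of_deriv_neg {f : ℝ → ℝ} {f' κ t : ℝ} (ht : 0 ≤ t)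
    (hf : HasDerivWithinAt f f' (Ici 0) t) (hle : f t ≤ κ) (hneg : f t = κ → f' < 0) :
    ∀ᶠ s in 𝓝[>] t, f s ≤ κ := by
  have hf' : HasDerivWithinAt f f' (Ioi t) t :=
    hf.mono fun s hs => ht.trans (le_of_lt hs)
  rcases hle.lt_or_eq with hlt | heq
  · exact (hf'.continuousWithinAt.eventually (gt_mem_nhds hlt)).mono fun s hs => hs.le
  · have hs := (hasDerivWithinAt_iff_tendsto_slope' self_notMem_Ioi).1 hf'
    filter_upwards [hs.eventually (gt_mem_nhds (hneg heq)), self_mem_nhdsWithin] with s h1 h2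
    rw [slope_def_field, div_neg_iff] at h1
    have : t < s := h2
    rcases h1 with h1 | h1 <;> linarith [h1.1, h1.2]

/-- The derivative to the right, in the form in which the Grönwall estimates ask for it. -/
lemma _root_.IsIntegralCurveOn.hasDerivWithinAt_Ici (hx : IsIntegralCurveOn x (fun _ => v) (Ici 0))
    {t : ℝ} (ht : 0 ≤ t) : HasDerivWithinAt x (v (x t)) (Ici t) t :=
  (hx t ht).mono (Ici_subset_Ici.2 ht)

lemma _root_.IsIntegralCurveOn.shift (hx : IsIntegralCurveOn x (fun _ => v) (Ici 0)) {a : ℝ}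
    (ha : 0 ≤ a) : IsIntegralCurveOn (fun t => x (a + t)) (fun _ => v) (Ici 0) := by
  intro t ht
  have h := (hx (a + t) (add_nonneg ha ht)).scomp t (s := Ici 0)
    ((hasDerivWithinAt_id t (Ici 0)).const_add a) (fun s hs => add_nonneg ha hs)
  simpa [Function.comp_def] using h

/-- Grönwall's estimate for two solutions that stay where the field is Lipschitz. -/
lemma dist_le_of_integralCurves {K : ℝ≥0} {S : Set E} (hv : LipschitzOnWith K v S)
    (hx : IsIntegralCurveOn x (fun _ => v) (Ici 0)) (hxS : ∀ t, 0 ≤ t → x t ∈ S)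
    (hy : IsIntegralCurveOn y (fun _ => v) (Ici 0)) (hyS : ∀ t, 0 ≤ t → y t ∈ S)
    {t : ℝ} (ht : 0 ≤ t) : dist (x t) (y t) ≤ dist (x 0) (y 0) * Real.exp (K * t) := by
  have := dist_le_of_trajectories_ODE_of_mem (v := fun _ => v) (s := fun _ => S) (a := 0) (b := t)
    (fun _ _ => hv)
    (hx.continuousOn.mono Icc_subset_Ici_self)
    (fun s hs => hx.hasDerivWithinAt_Ici hs.1) (fun s hs => hxS s hs.1)
    (hy.continuousOn.mono Icc_subset_Ici_self)
    (fun s hs => hy.hasDerivWithinAt_Ici hs.1) (fun s hs => hyS s hs.1)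
    le_rfl t ⟨ht, le_rfl⟩
  simpa using this

lemma eqOn_of_integralCurves {K : ℝ≥0} {S : Set E} (hv : LipschitzOnWith K v S)
    (hx : IsIntegralCurveOn x (fun _ => v) (Ici 0)) (hxS : ∀ t, 0 ≤ t → x t ∈ S)
    (hy : IsIntegralCurveOn y (fun _ => v) (Ici 0)) (hyS : ∀ t, 0 ≤ t → y t ∈ S)
    (h0 : x 0 = y 0) : EqOn x y (Ici 0) := by
  intro t ht
  have := dist_le_of_integralCurves hv hx hxS hy hyS ht
  rw [h0, dist_self, zero_mul] at this
  exact dist_le_zero.1 this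

/-- A bounded Lipschitz field has a solution on `[0, ∞)` from every point: Picard–Lindelöf applies
on every `[0, n]`, since the bound keeps solutions inside a ball, and the solutions agree. -/
theorem exists_integralCurve_of_lipschitz_of_bounded [CompleteSpace E] {K : ℝ≥0}
    (hv : LipschitzWith K v) {M : ℝ≥0} (hM : ∀ p, ‖v p‖ ≤ M) (x₀ : E) :
    ∃ x : ℝ → E, x 0 = x₀ ∧ IsIntegralCurveOn x (fun _ => v) (Ici 0) := by
  have hloc : ∀ n : ℕ, ∃ α : ℝ → E, α 0 = x₀ ∧
      ∀ t ∈ Icc (0 : ℝ) n, HasDerivWithinAt α (v (α t)) (Icc 0 n) t := by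
    intro n
    have h0 : (0 : ℝ) ∈ Icc (0 : ℝ) n := ⟨le_rfl, n.cast_nonneg⟩
    have hP : IsPicardLindelof (fun _ => v) (⟨0, h0⟩ : Icc (0 : ℝ) n) x₀ (M * n) 0 M K :=
      { lipschitzOnWith := fun _ _ => hv.lipschitzOnWith
        continuousOn := fun _ _ => continuousOn_const
        norm_le := fun _ _ p _ => hM p
        mul_max_le := by simp }
    exact hP.exists_eq_forall_mem_Icc_hasDerivWithinAt₀
  choose α hα0 hα using hloc
  have hder : ∀ (n : ℕ) (t : ℝ), t ∈ Ico (0 : ℝ) n →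
      HasDerivWithinAt (α n) (v (α n t)) (Ici 0) t := by
    intro n t ht
    refine (hα n t ⟨ht.1, ht.2.le⟩).mono_of_mem_nhdsWithin ?_
    filter_upwards [self_mem_nhdsWithin, mem_nhdsWithin_of_mem_nhds (Iio_mem_nhds ht.2)] with s h1 h2
    exact ⟨h1, le_of_lt h2⟩
  have hagree : ∀ m n : ℕ, m ≤ n → EqOn (α m) (α n) (Icc 0 m) := by
    intro m n hmn
    have hmn' : (m : ℝ) ≤ n := by exact_mod_cast hmn
    refine ODE_solution_unique (v := fun _ => v) (fun _ => hv)
      (fun t ht => (hα m t ht).continuousWithinAt)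
      (fun t ht => (hder m t ht).mono (Ici_subset_Ici.2 ht.1))
      (fun t ht => ((hα n t ⟨ht.1, ht.2.trans hmn'⟩).continuousWithinAt).mono
        (Icc_subset_Icc_right hmn'))
      (fun t ht => (hder n t ⟨ht.1, ht.2.trans_le hmn'⟩).mono (Ici_subset_Ici.2 ht.1)) ?_
    rw [hα0, hα0]
  let x : ℝ → E := fun t => α (⌊t⌋₊ + 1) t
  have hx : ∀ n : ℕ, EqOn x (α n) (Ico 0 n) := by
    intro n t ht
    have h1 : ⌊t⌋₊ + 1 ≤ n := (Nat.floor_lt ht.1).2 ht.2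
    exact hagree _ _ h1 ⟨ht.1, by push_cast; exact (Nat.lt_floor_add_one t).le⟩
  refine ⟨x, by simp [x, hα0], fun t ht => ?_⟩
  obtain ⟨n, hn⟩ := exists_nat_gt t
  have htn : t ∈ Ico (0 : ℝ) n := ⟨ht, hn⟩
  have hev : x =ᶠ[𝓝[Ici 0] t] α n := by
    filter_upwards [self_mem_nhdsWithin, mem_nhdsWithin_of_mem_nhds (Iio_mem_nhds hn)] with s h1 h2
    exact hx n ⟨h1, h2⟩
  rw [hx n htn]
  exact (hder n t htn).congr_of_eventuallyEq hev (hx n htn)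

/-- LaSalle's principle for a function `V` that does not increase along the solutions in a compact
set and decreases strictly at some time along every solution not starting at `p₀`: if `p` is a
limit point of a solution, then `V` is constant along the solution from `p`, because that solution
is a limit of time shifts of the given one. -/
theorem tendsto_of_lyapunov {K : ℝ≥0} {S : Set E} {p₀ : E} {V : E → ℝ} (hS : IsCompact S)
    (hv : LipschitzOnWith K v S) (hV : ContinuousOn V S)
    (hanti : ∀ z : ℝ → E, IsIntegralCurveOn z (fun _ => v) (Ici 0) → (∀ t, 0 ≤ t → z t ∈ S) →
      AntitoneOn (V ∘ z) (Ici 0))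
    (hstrict : ∀ p ∈ S, p ≠ p₀ → ∃ z : ℝ → E, z 0 = p ∧ IsIntegralCurveOn z (fun _ => v) (Ici 0) ∧
      (∀ t, 0 ≤ t → z t ∈ S) ∧ ∃ s, 0 ≤ s ∧ V (z s) < V p)
    (hx : IsIntegralCurveOn x (fun _ => v) (Ici 0)) (hxS : ∀ t, 0 ≤ t → x t ∈ S) :
    Tendsto x atTop (𝓝 p₀) := by
  refine hS.tendsto_nhds_of_unique_mapClusterPt
    ((eventually_ge_atTop 0).mono fun t ht => hxS t ht) fun p hp hcl => ?_
  by_contra hne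
  obtain ⟨z, hz0, hz, hzS, s, hs, hlt⟩ := hstrict p hp hne
  obtain ⟨C, hC⟩ := hS.bddBelow_image hV
  -- `V` converges along `x`; `max t 0` makes the monotone function total
  have hanti' : Antitone fun t : ℝ => V (x (max t 0)) := fun a b hab =>
    hanti x hx hxS (le_max_right a 0) (le_max_right b 0) (max_le_max_right 0 hab)
  have hlim : ∃ l, Tendsto (fun t => V (x t)) atTop (𝓝 l) := by
    have hb : BddBelow (range fun t : ℝ => V (x (max t 0))) :=
      ⟨C, by rintro _ ⟨t, rfl⟩; exact hC ⟨_, hxS _ (le_max_right _ _), rfl⟩⟩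
    refine ⟨_, (tendsto_atTop_ciInf hanti' hb).congr' ?_⟩
    filter_upwards [eventually_ge_atTop 0] with t ht
    rw [max_eq_left ht]
  obtain ⟨l, hl⟩ := hlim
  -- along an ultrafilter `u` of times at which `x` tends to `p`, the limit of `V` is computed at `p`
  -- and, by Grönwall's estimate, at `z s`
  obtain ⟨u, hu, hup⟩ := (mapClusterPt_iff_ultrafilter.1 hcl)
  have hu0 : ∀ᶠ t in (u : Filter ℝ), 0 ≤ t := hu (eventually_ge_atTop 0)
  have hVp : Tendsto (fun t => V (x t)) u (𝓝 (V p)) :=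
    (hV p hp).tendsto.comp (tendsto_nhdsWithin_iff.2 ⟨hup, hu0.mono fun t ht => hxS t ht⟩)
  have hlp : V p = l := tendsto_nhds_unique hVp (hl.mono_left hu)
  have hshift : Tendsto (fun t => x (t + s)) u (𝓝 (z s)) := by
    refine tendsto_iff_dist_tendsto_zero.2 ?_
    have hb : Tendsto (fun t => dist (x t) p * Real.exp (K * s)) u (𝓝 0) := by
      simpa using (tendsto_iff_dist_tendsto_zero.1 hup).mul_const (Real.exp (K * s))
    refine squeeze_zero' (Eventually.of_forall fun _ => dist_nonneg) ?_ hb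
    filter_upwards [hu0] with t ht
    simpa [hz0] using dist_le_of_integralCurves hv (hx.shift ht)
      (fun r hr => hxS _ (add_nonneg ht hr)) hz hzS hs
  have hVs : Tendsto (fun t => V (x (t + s))) u (𝓝 (V (z s))) :=
    (hV _ (hzS s hs)).tendsto.comp
      (tendsto_nhdsWithin_iff.2 ⟨hshift, hu0.mono fun t ht => hxS _ (add_nonneg ht hs)⟩)
  have hls : Tendsto (fun t => V (x (t + s))) u (𝓝 l) :=
    (hl.comp (tendsto_atTop_add_const_right _ s tendsto_id)).mono_left hu
  have := tendsto_nhds_unique hVs hls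
  linarith

end HalfLine

/-! ### Planar fields and invariant sets inside a box -/

/-- A field on the plane that is Lipschitz on a box has a solution on `[0, ∞)` from every point of a
closed subset `S` of the box, provided `S` is forward invariant. Invariance is asked of all curves
that follow the field as long as they are in `S`, because it is applied to a solution of the field
composed with the projection to the box. -/
theorem exists_integralCurve_mem_of_invariant {v : ℝ × ℝ → ℝ × ℝ} {K : NNReal}
    {a b : ℝ × ℝ} {S : Set (ℝ × ℝ)} (hv : LipschitzOnWith K v (Icc a b)) (hSab : S ⊆ Icc a b)
    (hinv : ∀ z : ℝ → ℝ × ℝ, ContinuousOn z (Ici 0) →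
      (∀ t, 0 ≤ t → z t ∈ S → HasDerivWithinAt z (v (z t)) (Ici 0) t) → z 0 ∈ S →
      ∀ t, 0 ≤ t → z t ∈ S)
    {x₀ : ℝ × ℝ} (hx₀ : x₀ ∈ S) :
    ∃ x : ℝ → ℝ × ℝ, x 0 = x₀ ∧ IsIntegralCurveOn x (fun _ => v) (Ici 0) ∧
      ∀ t, 0 ≤ t → x t ∈ S := by
  have hab : a ≤ b := (hSab hx₀).1.trans (hSab hx₀).2
  -- the projection to the box
  let π : ℝ × ℝ → ℝ × ℝ := fun p => (max a.1 (min b.1 p.1), max a.2 (min b.2 p.2))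
  have hπ : LipschitzWith 1 π := by
    have h1 := (LipschitzWith.prod_fst (α := ℝ) (β := ℝ)).const_min b.1 |>.const_max a.1
    have h2 := (LipschitzWith.prod_snd (α := ℝ) (β := ℝ)).const_min b.2 |>.const_max a.2
    simpa using h1.prodMk h2
  have hπmem : ∀ p, π p ∈ Icc a b := fun p =>
    ⟨⟨le_max_left _ _, le_max_left _ _⟩,
      ⟨max_le hab.1 (min_le_left _ _), max_le hab.2 (min_le_left _ _)⟩⟩
  have hπid : ∀ p ∈ Icc a b, π p = p := fun p hp =>
    Prod.ext (by simp [π, hp.1.1, hp.2.1]) (by simp [π, hp.1.2, hp.2.2])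
  have hw : LipschitzWith K (v ∘ π) := by
    have := hv.comp (hπ.lipschitzOnWith (s := univ)) (fun p _ => hπmem p)
    simpa [lipschitzOnWith_univ] using this
  obtain ⟨M, hM⟩ := (isCompact_Icc (a := a) (b := b)).exists_bound_of_continuousOn hv.continuousOn
  obtain ⟨x, hx0, hx⟩ := exists_integralCurve_of_lipschitz_of_bounded hw (M := M.toNNReal)
    (fun p => (hM _ (hπmem p)).trans (Real.le_coe_toNNReal M)) x₀
  have hcongr : ∀ t, 0 ≤ t → x t ∈ S → HasDerivWithinAt x (v (x t)) (Ici 0) t := by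
    intro t ht hxt
    have := hx t ht
    simpa [hπid _ (hSab hxt)] using this
  have hmem := hinv x hx.continuousOn hcongr (hx0 ▸ hx₀)
  exact ⟨x, hx0, fun t ht => hcongr t ht (hmem t ht), hmem⟩

/-! ### Score functions -/

section Score

variable {F : ℝ × ℝ → ℝ} {θl θu dl du : ℝ}

lemma mem_X_of_ne (p : ℝ × ℝ) (hp : p ∈ Ioo θl θu ×ˢ Ioo dl du) (hne : p ≠ (0, 0)) :
    p ∈ X θl θu dl du := by
  obtain ⟨x, y⟩ := p
  obtain ⟨⟨h1, h2⟩, h3, h4⟩ := hp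
  simp only at h1 h2 h3 h4
  simp only [X, X0, Q1, Q2, Q3, Q4, Q1L, Q3L, mem_union, mem_ofPred_eq, mem_Ioo, mem_Ico, mem_Ioc]
  rcases lt_trichotomy x 0 with hx | hx | hx <;> rcases lt_trichotomy y 0 with hy | hy | hy
  all_goals first
    | exact absurd (Prod.ext hx hy) hne
    | exact Or.inl (Or.inr ⟨⟨by linarith, by linarith⟩, by linarith, by linarith⟩)
    | exact Or.inr ⟨⟨by linarith, by linarith⟩, by linarith, by linarith⟩
    | exact Or.inl (Or.inl (Or.inr ⟨⟨by linarith, by linarith⟩, by linarith, by linarith⟩))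
    | exact Or.inl (Or.inl (Or.inl (Or.inl (Or.inr
        ⟨⟨by linarith, by linarith⟩, by linarith, by linarith⟩))))

/-- A continuous function on an interval is strictly decreasing if its derivative is negative away
from one point. -/
lemma strictAntiOn_Ioo_of_deriv_neg_of_ne {f : ℝ → ℝ} {a b c : ℝ} (hac : a < c) (hcb : c < b)
    (hf : ContinuousOn f (Ioo a b)) (hf' : ∀ x ∈ Ioo a b, x ≠ c → deriv f x < 0) :
    StrictAntiOn f (Ioo a b) := by
  have h1 : StrictAntiOn f (Ioc a c) := by
    refine strictAntiOn_of_deriv_neg (convex_Ioc a c)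
      (hf.mono fun x hx => ⟨hx.1, hx.2.trans_lt hcb⟩) fun x hx => ?_
    rw [interior_Ioc] at hx
    exact hf' x ⟨hx.1, hx.2.trans hcb⟩ hx.2.ne
  have h2 : StrictAntiOn f (Ico c b) := by
    refine strictAntiOn_of_deriv_neg (convex_Ico c b)
      (hf.mono fun x hx => ⟨hac.trans_le hx.1, hx.2⟩) fun x hx => ?_
    rw [interior_Ico] at hx
    exact hf' x ⟨hac.trans hx.1, hx.2⟩ hx.1.ne'
  have := h1.union h2 (isGreatest_Ioc hac) (isLeast_Ico hcb)
  rwa [Ioc_union_Ico_eq_Ioo hac hcb] at this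

variable (hF : IsScoreFunction F θl θu dl du) (hθl0 : θl < 0) (hθu0 : 0 < θu) (hdl : dl < 0)
  (hdu : 0 < du)
include hF hθl0 hθu0 hdl hdu

/-- A score function is strictly decreasing on the rectangle for the product order, also through
the origin, where its partial derivatives are not assumed to be negative. -/
lemma IsScoreFunction.lt_of_le_of_ne {p q : ℝ × ℝ} (hp : p ∈ Ioo θl θu ×ˢ Ioo dl du)
    (hq : q ∈ Ioo θl θu ×ˢ Ioo dl du) (h1 : p.1 ≤ q.1) (h2 : p.2 ≤ q.2) (hne : p ≠ q) :
    F q < F p := by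
  have hc := hF.contDiffOn.continuousOn
  have hθ : ∀ d ∈ Ioo dl du, StrictAntiOn (fun s => F (s, d)) (Ioo θl θu) := fun d hd =>
    strictAntiOn_Ioo_of_deriv_neg_of_ne hθl0 hθu0
      (hc.comp (by fun_prop) fun s hs => ⟨hs, hd⟩) fun s hs hs0 =>
        hF.partial_theta_neg (s, d) (mem_X_of_ne _ ⟨hs, hd⟩ fun h => hs0 (congrArg Prod.fst h))
  have hd : ∀ θ ∈ Ioo θl θu, StrictAntiOn (fun s => F (θ, s)) (Ioo dl du) := fun θ hθ =>
    strictAntiOn_Ioo_of_deriv_neg_of_ne hdl hdu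
      (hc.comp (by fun_prop) fun s hs => ⟨hθ, hs⟩) fun s hs hs0 =>
        hF.partial_d_neg (θ, s) (mem_X_of_ne _ ⟨hθ, hs⟩ fun h => hs0 (congrArg Prod.snd h))
  obtain ⟨a, b⟩ := p
  obtain ⟨a', b'⟩ := q
  have i1 : F (a', b') ≤ F (a, b') := (hθ b' hq.2).antitoneOn hp.1 hq.1 h1
  have i2 : F (a, b') ≤ F (a, b) := (hd a hp.1).antitoneOn hp.2 hq.2 h2
  rcases h1.lt_or_eq with h | h
  · exact ((hθ b' hq.2) hp.1 hq.1 h).trans_le i2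
  · rcases h2.lt_or_eq with h' | h'
    · exact i1.trans_lt ((hd a hp.1) hp.2 hq.2 h')
    · exact absurd (Prod.ext h h') hne

lemma IsScoreFunction.le_of_le {p q : ℝ × ℝ} (hp : p ∈ Ioo θl θu ×ˢ Ioo dl du)
    (hq : q ∈ Ioo θl θu ×ˢ Ioo dl du) (h1 : p.1 ≤ q.1) (h2 : p.2 ≤ q.2) : F q ≤ F p := by
  rcases eq_or_ne p q with rfl | hne
  · exact le_rfl
  · exact (hF.lt_of_le_of_ne hθl0 hθu0 hdl hdu hp hq h1 h2 hne).le

omit hF in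
lemma zero_mem_rect : ((0, 0) : ℝ × ℝ) ∈ Ioo θl θu ×ˢ Ioo dl du :=
  ⟨⟨hθl0, hθu0⟩, hdl, hdu⟩

lemma IsScoreFunction.neg_of_nonneg {p : ℝ × ℝ} (hp : p ∈ Ioo θl θu ×ˢ Ioo dl du)
    (h1 : 0 ≤ p.1) (h2 : 0 ≤ p.2) (hne : p ≠ (0, 0)) : F p < 0 :=
  hF.map_zero ▸ hF.lt_of_le_of_ne hθl0 hθu0 hdl hdu (zero_mem_rect hθl0 hθu0 hdl hdu) hp h1 h2
    hne.symm

lemma IsScoreFunction.pos_of_nonpos {p : ℝ × ℝ} (hp : p ∈ Ioo θl θu ×ˢ Ioo dl du)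
    (h1 : p.1 ≤ 0) (h2 : p.2 ≤ 0) (hne : p ≠ (0, 0)) : 0 < F p :=
  hF.map_zero ▸ hF.lt_of_le_of_ne hθl0 hθu0 hdl hdu hp (zero_mem_rect hθl0 hθu0 hdl hdu) h1 h2 hne

omit hθl0 hθu0 hdl hdu in
/-- The point reflection of a score function, which exchanges upper and lower bounds. -/
lemma IsScoreFunction.reflect :
    IsScoreFunction (fun p => -F (-p)) (-θu) (-θl) (-du) (-dl) := by
  have hX : ∀ p ∈ X (-θu) (-θl) (-du) (-dl), -p ∈ X θl θu dl du := by
    rintro ⟨x, y⟩ hp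
    simp only [X, X0, Q1, Q2, Q3, Q4, Q1L, Q3L, mem_union, mem_ofPred_eq, mem_Ioo, mem_Ico,
      mem_Ioc, Prod.neg_mk] at hp ⊢
    grind
  refine ⟨?_, by simp [hF.map_zero], fun p hp => ?_, fun p hp => ?_⟩
  · refine (hF.contDiffOn.comp contDiff_neg.contDiffOn ?_).neg
    rintro ⟨x, y⟩ ⟨⟨h1, h2⟩, h3, h4⟩
    exact ⟨⟨by simp_all [lt_neg], by simp_all [neg_lt]⟩, by simp_all [lt_neg], by simp_all [neg_lt]⟩
  · have h := hF.partial_theta_neg (-p) (hX p hp)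
    have e : deriv (fun s => -F (-(s, p.2))) p.1 = deriv (fun r => F (r, -p.2)) (-p.1) := by
      simpa using congrArg Neg.neg (deriv_comp_neg (f := fun r => F (r, -p.2)) p.1)
    rw [e]
    exact h
  · have h := hF.partial_d_neg (-p) (hX p hp)
    have e : deriv (fun s => -F (-(p.1, s))) p.2 = deriv (fun r => F (-p.1, r)) (-p.2) := by
      simpa using congrArg Neg.neg (deriv_comp_neg (f := fun r => F (-p.1, r)) p.2)
    rw [e]
    exact h

end Score

lemma ZeroCurveSpans.reflect {F : ℝ × ℝ → ℝ} {θl θu dl du : ℝ}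
    (hh : ZeroCurveSpans F θl θu dl du) :
    ZeroCurveSpans (fun p => -F (-p)) (-θu) (-θl) (-du) (-dl) := by
  intro d hd
  obtain ⟨θ, hθ, h0⟩ := hh (-d) ⟨by linarith [hd.2], by linarith [hd.1]⟩
  exact ⟨-θ, ⟨by linarith [hθ.2], by linarith [hθ.1]⟩, by simpa using h0⟩

/-! ### The Lyapunov function -/

section Lyapunov

/-- The score, multiplied by the factor `exp (u ^ 2)` that removes the damping of the second
equation by a change of time. -/
noncomputable def undamp (u : ℝ) : ℝ := u * Real.exp (u ^ 2)

lemma strictMono_undamp : StrictMono undamp := by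
  refine strictMono_of_deriv_pos fun u => ?_
  have h : HasDerivAt (fun u : ℝ => u * Real.exp (u ^ 2))
      (1 * Real.exp (u ^ 2) + u * (Real.exp (u ^ 2) * (2 * u))) u := by
    have := (hasDerivAt_id u).fun_mul ((hasDerivAt_pow 2 u).exp)
    simpa using this
  rw [show deriv undamp u = _ from h.deriv]
  have := Real.exp_pos (u ^ 2)
  nlinarith [mul_nonneg this.le (sq_nonneg u)]

lemma continuous_undamp : Continuous undamp := by unfold undamp; fun_prop

lemma undamp_pos {u : ℝ} (hu : 0 < u) : 0 < undamp u := mul_pos hu (Real.exp_pos _)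

lemma undamp_neg {u : ℝ} (hu : u < 0) : undamp u < 0 := mul_neg_of_neg_of_pos hu (Real.exp_pos _)

lemma exp_neg_mul_undamp (u : ℝ) : Real.exp (-1 * u ^ 2) * undamp u = u := by
  have : Real.exp (-1 * u ^ 2) * Real.exp (u ^ 2) = 1 := by rw [← Real.exp_add]; simp
  unfold undamp
  linear_combination u * this

/-- The part of the Lyapunov function that depends on the offset `d`. -/
noncomputable def offsetEnergy (F : ℝ × ℝ → ℝ) (d : ℝ) : ℝ := -∫ s in (0 : ℝ)..d, undamp (F (0, s))

/-- The Lyapunov function of the closed loop with `α = γ = 1`. -/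
noncomputable def energy (F : ℝ × ℝ → ℝ) (β : ℝ) (p : ℝ × ℝ) : ℝ :=
  β * (1 - Real.cos p.1) + offsetEnergy F p.2

variable {F : ℝ × ℝ → ℝ} {θl θu dl du β : ℝ}

lemma energy_zero : energy F β (0, 0) = 0 := by simp [energy, offsetEnergy]

variable (hF : IsScoreFunction F θl θu dl du) (hθl0 : θl < 0) (hθu0 : 0 < θu) (hdl : dl < 0)
  (hdu : 0 < du)
include hF hθl0 hθu0 hdl hdu

lemma hasDerivAt_offsetEnergy {d : ℝ} (hd : d ∈ Ioo dl du) :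
    HasDerivAt (offsetEnergy F) (-undamp (F (0, d))) d := by
  have hc : ContinuousOn (fun s => undamp (F (0, s))) (Ioo dl du) :=
    continuous_undamp.comp_continuousOn
      (hF.contDiffOn.continuousOn.comp (by fun_prop) fun s hs => ⟨⟨hθl0, hθu0⟩, hs⟩)
  refine (intervalIntegral.integral_hasDerivAt_right ?_ ?_ ?_).neg
  · refine (hc.mono ?_).intervalIntegrable
    exact (convex_Ioo dl du).ordConnected.uIcc_subset ⟨hdl, hdu⟩ hd
  · exact hc.stronglyMeasurableAtFilter isOpen_Ioo d hd
  · exact hc.continuousAt (isOpen_Ioo.mem_nhds hd)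

lemma continuousOn_energy : ContinuousOn (energy F β) (Ioo θl θu ×ˢ Ioo dl du) := by
  have h : ContinuousOn (offsetEnergy F) (Ioo dl du) := fun d hd =>
    (hasDerivAt_offsetEnergy hF hθl0 hθu0 hdl hdu hd).continuousAt.continuousWithinAt
  unfold energy
  exact ContinuousOn.add (by fun_prop) (h.comp continuousOn_snd fun p hp => hp.2)

lemma offsetEnergy_pos {d : ℝ} (hd : d ∈ Ioo dl du) (hd0 : d ≠ 0) : 0 < offsetEnergy F d := by
  have h0 : offsetEnergy F 0 = 0 := by simp [offsetEnergy]
  have hderiv := fun {s : ℝ} (hs : s ∈ Ioo dl du) =>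
    hasDerivAt_offsetEnergy hF hθl0 hθu0 hdl hdu hs
  rcases hd0.lt_or_gt with h | h
  · have hanti : StrictAntiOn (offsetEnergy F) (Ioc dl 0) := by
      refine strictAntiOn_of_deriv_neg (convex_Ioc dl 0)
        (fun s hs => (hderiv ⟨hs.1, hs.2.trans_lt hdu⟩).continuousAt.continuousWithinAt)
        fun s hs => ?_
      rw [interior_Ioc] at hs
      have hs' : s ∈ Ioo dl du := ⟨hs.1, hs.2.trans hdu⟩
      rw [(hderiv hs').deriv, neg_lt_zero]
      exact undamp_pos (hF.pos_of_nonpos hθl0 hθu0 hdl hdu (p := (0, s))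
        ⟨⟨hθl0, hθu0⟩, hs'⟩ le_rfl hs.2.le fun e => hs.2.ne (congrArg Prod.snd e))
    exact h0 ▸ hanti ⟨hd.1, h.le⟩ ⟨hdl, le_rfl⟩ h
  · have hmono : StrictMonoOn (offsetEnergy F) (Ico 0 du) := by
      refine strictMonoOn_of_deriv_pos (convex_Ico 0 du)
        (fun s hs => (hderiv ⟨hdl.trans_le hs.1, hs.2⟩).continuousAt.continuousWithinAt)
        fun s hs => ?_
      rw [interior_Ico] at hs
      have hs' : s ∈ Ioo dl du := ⟨hdl.trans hs.1, hs.2⟩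
      rw [(hderiv hs').deriv, neg_pos]
      exact undamp_neg (hF.neg_of_nonneg hθl0 hθu0 hdl hdu (p := (0, s))
        ⟨⟨hθl0, hθu0⟩, hs'⟩ le_rfl hs.1.le fun e => hs.1.ne' (congrArg Prod.snd e))
    exact h0 ▸ hmono ⟨le_rfl, hdu⟩ ⟨h.le, hd.2⟩ h

variable (hβ : 0 < β) (hθl : -Real.pi < θl) (hθu : θu < Real.pi)
include hβ hθl hθu

lemma energy_pos {p : ℝ × ℝ} (hp : p ∈ Ioo θl θu ×ˢ Ioo dl du) (hne : p ≠ (0, 0)) :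
    0 < energy F β p := by
  have hcos : 0 ≤ β * (1 - Real.cos p.1) :=
    mul_nonneg hβ.le (by linarith [Real.cos_le_one p.1])
  by_cases hd : p.2 = 0
  · have hθ : p.1 ≠ 0 := fun h => hne (Prod.ext h hd)
    have hcos' : Real.cos p.1 < 1 := (Real.cos_le_one _).lt_of_ne fun h => hθ
      ((Real.cos_eq_one_iff_of_lt_of_lt (by linarith [hp.1.1]) (by linarith [hp.1.2])).1 h)
    have : offsetEnergy F p.2 = 0 := by simp [hd, offsetEnergy]
    rw [energy, this, add_zero]
    exact mul_pos hβ (by linarith)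
  · exact add_pos_of_nonneg_of_pos hcos (offsetEnergy_pos hF hθl0 hθu0 hdl hdu hp.2 hd)

omit hβ hθl hθu in
lemma hasDerivWithinAt_energy {x : ℝ → ℝ × ℝ} {t : ℝ} {s : Set ℝ}
    (hx : HasDerivWithinAt x (closedLoop F 1 β 1 (x t)) s t)
    (hxt : x t ∈ Ioo θl θu ×ˢ Ioo dl du) :
    HasDerivWithinAt (fun r => energy F β (x r))
      (β * Real.exp (-1 * F (x t) ^ 2) * (Real.sin (x t).1 *
        (undamp (F (x t)) - undamp (F (0, (x t).2))))) s t := by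
  have h1 : HasDerivWithinAt (fun r => (x r).1) (closedLoop F 1 β 1 (x t)).1 s t := hx.fst
  have h2 : HasDerivWithinAt (fun r => (x r).2) (closedLoop F 1 β 1 (x t)).2 s t := hx.snd
  have h3 := ((h1.cos.const_sub 1).const_mul β).add
    ((hasDerivAt_offsetEnergy hF hθl0 hθu0 hdl hdu hxt.2).comp_hasDerivWithinAt t h2)
  refine h3.congr_deriv ?_
  simp only [closedLoop]
  linear_combination (-(β * Real.sin (x t).1)) * exp_neg_mul_undamp (F (x t))

omit hβ in
/-- The factor `undamp ∘ F` decreases in `θ`, so the energy decreases off the axis `θ = 0`. -/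
lemma energy_deriv_sign {p : ℝ × ℝ} (hp : p ∈ Ioo θl θu ×ˢ Ioo dl du) :
    Real.sin p.1 * (undamp (F p) - undamp (F (0, p.2))) ≤ 0 ∧
      (p.1 ≠ 0 → Real.sin p.1 * (undamp (F p) - undamp (F (0, p.2))) < 0) := by
  have hp0 : ((0, p.2) : ℝ × ℝ) ∈ Ioo θl θu ×ˢ Ioo dl du := ⟨⟨hθl0, hθu0⟩, hp.2⟩
  have key : p.1 ≠ 0 → Real.sin p.1 * (undamp (F p) - undamp (F (0, p.2))) < 0 := by
    intro h
    rcases h.lt_or_gt with h | h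
    · refine mul_neg_of_neg_of_pos (Real.sin_neg_of_neg_of_neg_pi_lt h (hθl.trans hp.1.1)) ?_
      exact sub_pos.2 (strictMono_undamp (hF.lt_of_le_of_ne hθl0 hθu0 hdl hdu hp hp0 h.le le_rfl
        fun e => h.ne (congrArg Prod.fst e)))
    · refine mul_neg_of_pos_of_neg (Real.sin_pos_of_pos_of_lt_pi h (hp.1.2.trans hθu)) ?_
      exact sub_neg.2 (strictMono_undamp (hF.lt_of_le_of_ne hθl0 hθu0 hdl hdu hp0 hp h.le le_rfl
        fun e => h.ne (congrArg Prod.fst e)))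
  refine ⟨?_, key⟩
  by_cases h : p.1 = 0
  · simp [h]
  · exact (key h).le

/-- The energy does not increase along a trajectory as long as it is in the rectangle. -/
lemma antitoneOn_energy {x : ℝ → ℝ × ℝ} {D : Set ℝ} (hD : Convex ℝ D)
    (hx : ∀ t ∈ D, HasDerivWithinAt x (closedLoop F 1 β 1 (x t)) D t)
    (hxR : ∀ t ∈ D, x t ∈ Ioo θl θu ×ˢ Ioo dl du) :
    AntitoneOn (energy F β ∘ x) D := by
  have hder := fun t ht => hasDerivWithinAt_energy hF hθl0 hθu0 hdl hdu (hx t ht) (hxR t ht)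
  refine antitoneOn_of_hasDerivWithinAt_nonpos hD (fun t ht => (hder t ht).continuousWithinAt)
    (fun t ht => (hder t (interior_subset ht)).mono interior_subset) fun t ht => ?_
  exact mul_nonpos_of_nonneg_of_nonpos (by positivity)
    (energy_deriv_sign hF hθl0 hθu0 hdl hdu hθl hθu (hxR t (interior_subset ht))).1

/-- A trajectory that does not start at the origin loses energy: otherwise it would have `θ = 0`
at all times, hence `F (0, d) = 0` and `d = 0`. -/
lemma exists_energy_lt {x : ℝ → ℝ × ℝ}
    (hx : IsIntegralCurveOn x (fun _ => closedLoop F 1 β 1) (Ici 0))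
    (hxR : ∀ t, 0 ≤ t → x t ∈ Ioo θl θu ×ˢ Ioo dl du) (hne : x 0 ≠ (0, 0)) :
    ∃ s, 0 ≤ s ∧ energy F β (x s) < energy F β (x 0) := by
  by_contra! hcon
  have hanti := antitoneOn_energy hF hθl0 hθu0 hdl hdu hβ hθl hθu (convex_Ici 0) hx hxR
  have huniq : ∀ t : ℝ, 0 ≤ t → UniqueDiffWithinAt ℝ (Ici (0 : ℝ)) t := fun t ht =>
    uniqueDiffOn_Ici 0 t ht
  have hconst : ∀ t, 0 ≤ t → energy F β (x t) = energy F β (x 0) := fun t ht =>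
    le_antisymm (hanti (mem_Ici.2 le_rfl) ht ht) (hcon t ht)
  have hθ : ∀ t, 0 ≤ t → (x t).1 = 0 := by
    intro t ht
    by_contra h
    have h1 := hasDerivWithinAt_energy hF hθl0 hθu0 hdl hdu (hx t ht) (hxR t ht)
    have h2 : HasDerivWithinAt (fun r => energy F β (x r)) 0 (Ici 0) t :=
      (hasDerivWithinAt_const t (Ici 0) (energy F β (x 0))).congr hconst (hconst t ht)
    have h3 := (huniq t ht).eq_deriv _ h1 h2
    have h4 := (energy_deriv_sign hF hθl0 hθu0 hdl hdu hθl hθu (hxR t ht)).2 h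
    have h5 := mul_neg_of_pos_of_neg (mul_pos hβ (Real.exp_pos (-1 * F (x t) ^ 2))) h4
    exact h5.ne h3
  have h1 : HasDerivWithinAt (fun r => (x r).1) (closedLoop F 1 β 1 (x 0)).1 (Ici 0) 0 :=
    (hx 0 (mem_Ici.2 le_rfl)).fst
  have h2 : HasDerivWithinAt (fun r => (x r).1) 0 (Ici 0) 0 :=
    (hasDerivWithinAt_const 0 (Ici 0) (0 : ℝ)).congr hθ (hθ 0 le_rfl)
  have h3 : F (x 0) = 0 := by
    simpa [closedLoop] using (huniq 0 le_rfl).eq_deriv _ h1 h2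
  have hx0 := hθ 0 le_rfl
  rcases le_total 0 (x 0).2 with h | h
  · exact (hF.neg_of_nonneg hθl0 hθu0 hdl hdu (hxR 0 le_rfl) hx0.ge h hne).ne h3
  · exact (hF.pos_of_nonpos hθl0 hθu0 hdl hdu (hxR 0 le_rfl) hx0.le h hne).ne' h3

/-- The origin is Lyapunov stable: a trajectory that starts in a small ball has less energy than
any point at distance `r`, so it never reaches that distance. -/
theorem lyapunov_stable :
    ∀ ε > 0, ∃ δ > 0, ∀ x₀ : ℝ × ℝ, ‖x₀‖ < δ → ∀ x : ℝ → ℝ × ℝ,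
      IsTrajectory F 1 β 1 x₀ x → ∀ t ≥ 0, ‖x t‖ < ε := by
  intro ε hε
  have hopen : IsOpen (Ioo θl θu ×ˢ Ioo dl du) := isOpen_Ioo.prod isOpen_Ioo
  have h0R := zero_mem_rect hθl0 hθu0 hdl hdu
  obtain ⟨ρ, hρ, hρR⟩ := Metric.isOpen_iff.1 hopen _ h0R
  obtain ⟨r, hr0, hr⟩ := exists_between (lt_min hε hρ)
  have hrR : ∀ p : ℝ × ℝ, ‖p‖ ≤ r → p ∈ Ioo θl θu ×ˢ Ioo dl du := fun p hp =>
    hρR (mem_ball_zero_iff.2 (hp.trans_lt (hr.trans_le (min_le_right _ _))))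
  have hcont : ContinuousOn (energy F β) (Ioo θl θu ×ˢ Ioo dl du) :=
    continuousOn_energy hF hθl0 hθu0 hdl hdu
  -- a lower bound of the energy on the sphere
  obtain ⟨q, hq, hmin⟩ := (isCompact_sphere (0 : ℝ × ℝ) r).exists_isMinOn
    ((NormedSpace.sphere_nonempty).2 hr0.le)
    (hcont.mono fun p hp => hrR p (mem_sphere_zero_iff_norm.1 hp).le)
  have hqn : ‖q‖ = r := mem_sphere_zero_iff_norm.1 hq
  have hm : 0 < energy F β q := energy_pos hF hθl0 hθu0 hdl hdu hβ hθl hθu (hrR q hqn.le)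
    fun h => by rw [h] at hqn; simp at hqn; linarith
  have hev : ∀ᶠ p in 𝓝 ((0, 0) : ℝ × ℝ), energy F β p < energy F β q :=
    (hcont.continuousAt (hopen.mem_nhds h0R)).eventually (gt_mem_nhds (by rwa [energy_zero]))
  obtain ⟨δ, hδ, hδV⟩ := Metric.eventually_nhds_iff_ball.1 hev
  refine ⟨min δ r, lt_min hδ hr0, fun x₀ hx₀ x hx t ht => ?_⟩
  have hxc : ContinuousOn x (Ici 0) := fun s hs => (hx.2 s hs).continuousWithinAt
  have hE0 : energy F β (x 0) < energy F β q := by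
    rw [hx.1]
    exact hδV x₀ (mem_ball_zero_iff.2 (hx₀.trans_le (min_le_left _ _)))
  have hball : ∀ t, 0 ≤ t → x t ∈ Metric.closedBall (0 : ℝ × ℝ) r := by
    refine forall_mem_of_eventually Metric.isClosed_closedBall hxc ?_ fun T hT hin => ?_
    · rw [hx.1, mem_closedBall_zero_iff]
      exact (hx₀.trans_le (min_le_right _ _)).le
    · have hanti := antitoneOn_energy hF hθl0 hθu0 hdl hdu hβ hθl hθu (convex_Icc 0 T)
        (fun s hs => (hx.2 s hs.1).mono Icc_subset_Ici_self)
        (fun s hs => hrR _ (mem_closedBall_zero_iff.1 (hin s hs)))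
      have hET : energy F β (x T) ≤ energy F β (x 0) := hanti ⟨le_rfl, hT⟩ ⟨hT, le_rfl⟩ hT
      have hle : ‖x T‖ ≤ r := mem_closedBall_zero_iff.1 (hin T ⟨hT, le_rfl⟩)
      have hlt : ‖x T‖ < r := hle.lt_of_ne fun h =>
        absurd (hmin (mem_sphere_zero_iff_norm.2 h)) (by simpa using hET.trans_lt hE0)
      have hxT : ContinuousWithinAt x (Ioi T) T :=
        (hxc T hT).mono fun s hs => hT.trans (le_of_lt hs)
      filter_upwards [hxT.norm.eventually (gt_mem_nhds hlt)] with s hs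
      exact mem_closedBall_zero_iff.2 hs.le
  exact (mem_closedBall_zero_iff.1 (hball t ht)).trans_lt (hr.trans_le (min_le_left _ _))

end Lyapunov

/-! ### Invariant hexagons -/

section Hexagon

variable {F : ℝ × ℝ → ℝ} {θl θu dl du β : ℝ}

/-- The linear form that is `1` on the line through `(2 a, 0)` and `(0, b)`. For `(a, b) = (θu, du)`
this line is flatter than the segment that bounds `Q1L`, so the form is less than `1` on `Q1L`; and
for `(a, b) = (θl, dl)` likewise on `Q3L`. Also on the segment itself it is less than `1`, which
leaves room for a bound by some `c < 1`; such a bound gives `d / b ≤ c` on the axis `θ = 0`. -/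
noncomputable def tilt (a b : ℝ) (p : ℝ × ℝ) : ℝ := p.2 / b + p.1 / (2 * a)

lemma tilt_neg (a b : ℝ) (p : ℝ × ℝ) : tilt (-a) (-b) (-p) = tilt a b p := by
  simp [tilt, neg_div_neg_eq]

lemma continuous_tilt (a b : ℝ) : Continuous (tilt a b) := by unfold tilt; fun_prop

lemma hasDerivWithinAt_tilt {x : ℝ → ℝ × ℝ} {x' : ℝ × ℝ} {s : Set ℝ} {t : ℝ} (a b : ℝ)
    (hx : HasDerivWithinAt x x' s t) :
    HasDerivWithinAt (fun r => tilt a b (x r)) (tilt a b x') s t := by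
  have h1 : HasDerivWithinAt (fun r => (x r).1) x'.1 s t := hx.fst
  have h2 : HasDerivWithinAt (fun r => (x r).2) x'.2 s t := hx.snd
  exact (h2.div_const b).add (h1.div_const (2 * a))

lemma closedLoop_reflect (p : ℝ × ℝ) :
    closedLoop (fun q => -F (-q)) 1 β 1 (-p) = -closedLoop F 1 β 1 p := by
  simp [closedLoop]

/-- The initial states satisfy both tilted bounds strictly. -/
lemma tilt_lt_one_of_mem_X0 (hθl0 : θl < 0) (hθu0 : 0 < θu) (hdl : dl < 0) (hdu : 0 < du)
    {p : ℝ × ℝ} (hp : p ∈ X0 θl θu dl du) :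
    p ∈ Ioo θl θu ×ˢ Ioo dl du ∧ tilt θu du p < 1 ∧ tilt θl dl p < 1 := by
  have h2u : (0 : ℝ) < 2 * θu := by linarith
  have h2l : 2 * θl < (0 : ℝ) := by linarith
  obtain ⟨x, y⟩ := p
  have eu : x / (2 * θu) = x / θu / 2 := by rw [mul_comm, div_div]
  have el : x / (2 * θl) = x / θl / 2 := by rw [mul_comm, div_div]
  simp only [tilt]
  rw [eu, el]
  rcases hp with ((⟨⟨⟨h1, h2⟩, h3, h4⟩, h5⟩ | ⟨⟨h1, h2⟩, h3, h4⟩) | ⟨⟨⟨h1, h2⟩, h3, h4⟩, h5⟩) |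
    ⟨⟨h1, h2⟩, h3, h4⟩ <;> simp only at h1 h2 h3 h4
  · have e : y / du ≤ 1 - x / θu := by
      rw [div_le_iff₀ hdu]; simp only at h5; linear_combination h5
    have i1 : 0 < x / θu := div_pos h1 hθu0
    have i2 : x / θl < 0 := div_neg_of_pos_of_neg h1 hθl0
    have i3 : y / dl ≤ 0 := div_nonpos_of_nonneg_of_nonpos h3 hdl.le
    exact ⟨⟨⟨by linarith, h2⟩, by linarith, h4⟩, by linarith, by linarith⟩
  · have i1 : x / θu ≤ 0 := div_nonpos_of_nonpos_of_nonneg h2 hθu0.le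
    have i2 : y / du < 1 := (div_lt_one hdu).2 h4
    have i3 : y / dl < 0 := div_neg_of_pos_of_neg h3 hdl
    have i4 : x / θl < 1 := (div_lt_one_of_neg hθl0).2 h1
    exact ⟨⟨⟨h1, by linarith⟩, by linarith, h4⟩, by linarith, by linarith⟩
  · have e : y / dl ≤ 1 - x / θl := by
      rw [div_le_iff_of_neg hdl]; simp only at h5; linear_combination h5
    have i1 : 0 < x / θl := div_pos_of_neg_of_neg h2 hθl0
    have i2 : x / θu < 0 := div_neg_of_neg_of_pos h2 hθu0
    have i3 : y / du ≤ 0 := div_nonpos_of_nonpos_of_nonneg h4 hdu.le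
    exact ⟨⟨⟨h1, by linarith⟩, h3, by linarith⟩, by linarith, by linarith⟩
  · have i1 : x / θl ≤ 0 := div_nonpos_of_nonneg_of_nonpos h1 hθl0.le
    have i2 : y / dl < 1 := (div_lt_one_of_neg hdl).2 h3
    have i3 : y / du < 0 := div_neg_of_neg_of_pos h4 hdu
    have i4 : x / θu < 1 := (div_lt_one hθu0).2 h2
    exact ⟨⟨⟨by linarith, h2⟩, h3, by linarith⟩, by linarith, by linarith⟩

/-- The condition on `β` under which `tilt θu du` decreases along the closed loop in the part of
the closed first quadrant where it is at least `1 / 2`. -/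
def SlowGain (F : ℝ × ℝ → ℝ) (θl θu dl du β : ℝ) : Prop :=
  ∀ p ∈ Ioo θl θu ×ˢ Ioo dl du, 0 ≤ p.1 → 0 ≤ p.2 → 1 / 2 ≤ tilt θu du p →
    β / du + F p / (2 * θu) < 0

lemma SlowGain.mono {β' : ℝ} (h : SlowGain F θl θu dl du β) (hdu : 0 < du) (hβ : β' ≤ β) :
    SlowGain F θl θu dl du β' := fun p hp h1 h2 h3 => by
  have : β' / du ≤ β / du := div_le_div_of_nonneg_right hβ hdu.le
  linarith [h p hp h1 h2 h3]

variable (hF : IsScoreFunction F θl θu dl du) (hθl0 : θl < 0) (hθu0 : 0 < θu) (hdl : dl < 0)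
  (hdu : 0 < du)
include hF hθl0 hθu0 hdl hdu

/-- A small `β` is slow enough, since `F` is bounded away from `0` where it matters. -/
lemma exists_slowGain : ∃ β, 0 < β ∧ SlowGain F θl θu dl du β := by
  have m1 : ((θu / 2, 0) : ℝ × ℝ) ∈ Ioo θl θu ×ˢ Ioo dl du :=
    ⟨⟨by simp only; linarith, by simp only; linarith⟩, hdl, hdu⟩
  have m2 : ((0, du / 4) : ℝ × ℝ) ∈ Ioo θl θu ×ˢ Ioo dl du :=
    ⟨⟨hθl0, hθu0⟩, by simp only; linarith, by simp only; linarith⟩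
  have n1 : F (θu / 2, 0) < 0 := hF.neg_of_nonneg hθl0 hθu0 hdl hdu m1 (by simp only; linarith)
    le_rfl fun e => by have := congrArg Prod.fst e; simp only at this; linarith
  have n2 : F (0, du / 4) < 0 := hF.neg_of_nonneg hθl0 hθu0 hdl hdu m2 le_rfl
    (by simp only; linarith) fun e => by have := congrArg Prod.snd e; simp only at this; linarith
  obtain ⟨m, hm0, hm1, hm2⟩ : ∃ m : ℝ, 0 < m ∧ F (θu / 2, 0) ≤ -m ∧ F (0, du / 4) ≤ -m :=
    ⟨-max (F (θu / 2, 0)) (F (0, du / 4)), by simp [n1, n2], by simp, by simp⟩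
  refine ⟨du * (m / (4 * θu)), by positivity, fun p hp h1 h2 h3 => ?_⟩
  -- a tilt of at least `1 / 2` forces `θ ≥ θu / 2` or `d ≥ du / 4`
  have hFp : F p ≤ -m := by
    rcases le_or_gt (θu / 2) p.1 with h | h
    · exact (hF.le_of_le hθl0 hθu0 hdl hdu m1 hp h h2).trans hm1
    · refine (hF.le_of_le hθl0 hθu0 hdl hdu m2 hp h1 ?_).trans hm2
      have i1 : p.1 / (2 * θu) < 1 / 4 := by rw [div_lt_iff₀ (by linarith)]; linarith
      have i2 : 1 / 4 ≤ p.2 / du := by unfold tilt at h3; linarith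
      rw [le_div_iff₀ hdu] at i2
      simp only; linarith
  have e1 : du * (m / (4 * θu)) / du = m / (4 * θu) := mul_div_cancel_left₀ _ hdu.ne'
  have e2 : F p / (2 * θu) ≤ -m / (2 * θu) := div_le_div_of_nonneg_right hFp (by linarith)
  have e3 : -m / (2 * θu) = -(2 * (m / (4 * θu))) := by field_simp; norm_num
  have e4 : 0 < m / (4 * θu) := by positivity
  rw [e1]
  linarith

variable (hθl : -Real.pi < θl) (hh : ZeroCurveSpans F θl θu dl du) (hβ0 : 0 < β)
  (hβ : SlowGain F θl θu dl du β)
include hθl hh hβ0 hβ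

/-- The left, the top and the upper tilted side of the hexagon, through which the closed loop
points inwards. The tilted side continues above the height `c * du`, to the left of the axis
`θ = 0`, and meets the top side at a point with `θ < 0`: so `sin θ < 0` on the whole top side. -/
lemma exists_upper_sides {c θ₀ : ℝ} (hc : 1 / 2 ≤ c) (hc1 : c < 1) (hθ₀ : θl < θ₀) :
    ∃ a b, θl < a ∧ a ≤ θ₀ ∧ c * du < b ∧ b < du ∧
      ∀ p ∈ Ioo θl θu ×ˢ Ioo dl du, p.2 ≤ b → tilt θu du p ≤ c →
        (p.1 = a → 0 < (closedLoop F 1 β 1 p).1) ∧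
        (p.2 = b → (closedLoop F 1 β 1 p).2 < 0) ∧
        (tilt θu du p = c → tilt θu du (closedLoop F 1 β 1 p) < 0) := by
  have h2u : (0 : ℝ) < 2 * θu := by linarith
  have hcd : 0 < c * du := by positivity
  have hcd1 : c * du < du := by nlinarith
  obtain ⟨η, hη0, hηθ, hηc, hηF⟩ : ∃ η : ℝ, 0 < η ∧ η < -θl ∧ η < (1 - c) * (2 * θu) ∧
      F (-η, c * du) < 0 := by
    have hm : ((-0, c * du) : ℝ × ℝ) ∈ Ioo θl θu ×ˢ Ioo dl du :=
      ⟨⟨by simpa, by simpa⟩, by simp only; linarith, hcd1⟩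
    have hneg : F (-0, c * du) < 0 := hF.neg_of_nonneg hθl0 hθu0 hdl hdu hm (by simp) hcd.le
      fun e => by have := congrArg Prod.snd e; simp only at this; linarith
    have hcont : ContinuousAt (fun s : ℝ => F (-s, c * du)) 0 :=
      ContinuousAt.comp (f := fun s : ℝ => ((-s, c * du) : ℝ × ℝ)) (g := F)
        (hF.contDiffOn.continuousOn.continuousAt ((isOpen_Ioo.prod isOpen_Ioo).mem_nhds hm))
        (by fun_prop)
    have ev := (hcont.eventually (gt_mem_nhds hneg)).and
      ((gt_mem_nhds (show (0 : ℝ) < -θl by linarith)).and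
        (gt_mem_nhds (show (0 : ℝ) < (1 - c) * (2 * θu) from mul_pos (by linarith) h2u)))
    obtain ⟨η, ⟨h1, h2, h3⟩, h4⟩ :=
      ((ev.filter_mono nhdsWithin_le_nhds).and (self_mem_nhdsWithin (s := Ioi (0 : ℝ)))).exists
    exact ⟨η, h4, h2, h3, h1⟩
  have hηq : η / (2 * θu) < 1 - c := (div_lt_iff₀ h2u).2 hηc
  have hηq0 : 0 < η / (2 * θu) := by positivity
  -- the height at which the tilted side reaches `θ = -η`
  obtain ⟨b, hb⟩ : ∃ b, b = du * (c + η / (2 * θu)) := ⟨_, rfl⟩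
  have hbc : c * du < b := by rw [hb]; nlinarith
  have hbd : b < du := by rw [hb]; nlinarith
  have hbq : b / du = c + η / (2 * θu) := by rw [hb]; exact mul_div_cancel_left₀ _ hdu.ne'
  obtain ⟨θ', hθ', hz⟩ := hh b ⟨by linarith, hbd⟩
  obtain ⟨a, ha, ham⟩ := exists_between (lt_min hθ₀ hθ'.1)
  have haθ₀ := ham.trans_le (min_le_left _ _)
  have haθ' := ham.trans_le (min_le_right _ _)
  have hbR : b ∈ Ioo dl du := ⟨by linarith, hbd⟩
  have haR : ((a, b) : ℝ × ℝ) ∈ Ioo θl θu ×ˢ Ioo dl du := ⟨⟨ha, haθ'.trans hθ'.2⟩, hbR⟩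
  have hFab : 0 < F (a, b) := hz ▸ hF.lt_of_le_of_ne hθl0 hθu0 hdl hdu (q := (θ', b)) haR
    ⟨hθ', hbR⟩ haθ'.le le_rfl fun e => haθ'.ne (congrArg Prod.fst e)
  refine ⟨a, b, ha, haθ₀.le, hbc, hbd, fun p hp hpb hpc => ⟨fun hpa => ?_, fun hpb' => ?_,
    fun hpc' => ?_⟩⟩
  · have := hF.le_of_le hθl0 hθu0 hdl hdu hp haR hpa.le hpb
    simp only [closedLoop, one_mul]
    linarith
  · have hneg : p.1 / (2 * θu) ≤ -η / (2 * θu) := by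
      unfold tilt at hpc
      rw [hpb', hbq] at hpc
      rw [neg_div]
      linarith
    have hneg' : p.1 ≤ -η := (div_le_div_iff_of_pos_right h2u).1 hneg
    exact mul_neg_of_pos_of_neg (mul_pos hβ0 (Real.exp_pos _))
      (Real.sin_neg_of_neg_of_neg_pi_lt (by linarith) (hθl.trans hp.1.1))
  · have hexp0 := Real.exp_pos (-1 * F p ^ 2)
    have hexp : Real.exp (-1 * F p ^ 2) ≤ 1 := Real.exp_le_one_iff.2 (by nlinarith [sq_nonneg (F p)])
    simp only [tilt, closedLoop, one_mul]
    rcases le_or_gt 0 p.1 with h | h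
    · have hp2 : 0 ≤ p.2 := by
        by_contra hlt
        have i1 : p.2 / du < 0 := div_neg_of_neg_of_pos (not_le.1 hlt) hdu
        have i2 : p.1 / (2 * θu) < 1 / 2 := by rw [div_lt_iff₀ h2u]; linarith [hp.1.2]
        unfold tilt at hpc'
        linarith
      have hs := hβ p hp h hp2 (hpc' ▸ hc)
      have i1 : β * Real.exp (-1 * F p ^ 2) ≤ β := mul_le_of_le_one_right hβ0.le hexp
      have i2 : β * Real.exp (-1 * F p ^ 2) * Real.sin p.1 ≤ β * Real.exp (-1 * F p ^ 2) :=
        mul_le_of_le_one_right (by positivity) (Real.sin_le_one _)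
      have i3 := div_le_div_of_nonneg_right (i2.trans i1) hdu.le
      linarith
    · have hq : p.1 / (2 * θu) < 0 := div_neg_of_neg_of_pos h h2u
      have e1 : p.2 / du = c - p.1 / (2 * θu) := by unfold tilt at hpc'; linarith
      have i1 : c * du ≤ p.2 := by rw [← le_div_iff₀ hdu]; linarith
      have i2 : -η ≤ p.1 := by
        have : p.2 / du ≤ b / du := div_le_div_of_nonneg_right hpb hdu.le
        refine (div_le_div_iff_of_pos_right h2u).1 ?_
        rw [neg_div]
        linarith
      have hFp : F p < 0 := (hF.le_of_le hθl0 hθu0 hdl hdu (p := (-η, c * du))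
        ⟨⟨by simp only; linarith, by simp only; linarith⟩, by simp only; linarith, hcd1⟩
        hp i2 i1).trans_lt hηF
      have hsin := Real.sin_neg_of_neg_of_neg_pi_lt h (hθl.trans hp.1.1)
      have j1 : β * Real.exp (-1 * F p ^ 2) * Real.sin p.1 / du < 0 :=
        div_neg_of_neg_of_pos (mul_neg_of_pos_of_neg (by positivity) hsin) hdu
      have j2 : F p / (2 * θu) < 0 := div_neg_of_neg_of_pos hFp h2u
      linarith

variable (hθu : θu < Real.pi)
  (hβ' : SlowGain (fun p => -F (-p)) (-θu) (-θl) (-du) (-dl) β)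
include hθu hβ'

omit hθl hβ in
/-- The right, the bottom and the lower tilted side: the point reflection of
`exists_upper_sides`. -/
lemma exists_lower_sides {c θ₀ : ℝ} (hc : 1 / 2 ≤ c) (hc1 : c < 1) (hθ₀ : θ₀ < θu) :
    ∃ a b, θ₀ ≤ a ∧ a < θu ∧ dl < b ∧ b < c * dl ∧
      ∀ p ∈ Ioo θl θu ×ˢ Ioo dl du, b ≤ p.2 → tilt θl dl p ≤ c →
        (p.1 = a → (closedLoop F 1 β 1 p).1 < 0) ∧
        (p.2 = b → 0 < (closedLoop F 1 β 1 p).2) ∧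
        (tilt θl dl p = c → tilt θl dl (closedLoop F 1 β 1 p) < 0) := by
  obtain ⟨a, b, h1, h2, h3, h4, h⟩ := exists_upper_sides hF.reflect (neg_lt_zero.2 hθu0)
    (neg_pos.2 hθl0) (neg_lt_zero.2 hdu) (neg_pos.2 hdl) (neg_lt_neg hθu) hh.reflect hβ0 hβ'
    hc hc1 (neg_lt_neg hθ₀)
  refine ⟨-a, -b, by linarith, by linarith, by linarith, by linarith, fun p hp hpb hpc => ?_⟩
  have hp' : -p ∈ Ioo (-θu) (-θl) ×ˢ Ioo (-du) (-dl) :=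
    ⟨⟨neg_lt_neg hp.1.2, neg_lt_neg hp.1.1⟩, neg_lt_neg hp.2.2, neg_lt_neg hp.2.1⟩
  have := h (-p) hp' (by simp only [Prod.snd_neg]; linarith) (by rwa [tilt_neg])
  rw [closedLoop_reflect, tilt_neg, tilt_neg] at this
  simp only [Prod.fst_neg, Prod.snd_neg, neg_pos, neg_lt_zero] at this
  exact ⟨fun e => this.1 (by linarith), fun e => this.2.1 (by linarith), this.2.2⟩

/-- Every point of the rectangle that satisfies both tilted bounds lies in a closed set, inside a
compact box in the rectangle, that no curve following the closed loop can leave. -/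
theorem exists_invariant_hexagon {x₀ : ℝ × ℝ} (hx₀ : x₀ ∈ Ioo θl θu ×ˢ Ioo dl du)
    (hu : tilt θu du x₀ < 1) (hl : tilt θl dl x₀ < 1) :
    ∃ (a b : ℝ × ℝ) (S : Set (ℝ × ℝ)), x₀ ∈ S ∧ IsClosed S ∧ S ⊆ Icc a b ∧
      Icc a b ⊆ Ioo θl θu ×ˢ Ioo dl du ∧
      ∀ z : ℝ → ℝ × ℝ, ContinuousOn z (Ici 0) →
        (∀ t, 0 ≤ t → z t ∈ S → HasDerivWithinAt z (closedLoop F 1 β 1 (z t)) (Ici 0) t) →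
        z 0 ∈ S → ∀ t, 0 ≤ t → z t ∈ S := by
  have hdu1 : x₀.2 / du < 1 := (div_lt_one hdu).2 hx₀.2.2
  have hdl1 : x₀.2 / dl < 1 := (div_lt_one_of_neg hdl).2 hx₀.2.1
  obtain ⟨c, hcm, hc1⟩ := exists_between (max_lt (max_lt hu hl)
    (max_lt (max_lt hdu1 hdl1) (show (1 / 2 : ℝ) < 1 by norm_num)))
  simp only [max_lt_iff] at hcm
  obtain ⟨⟨hcu, hcl⟩, ⟨hcdu, hcdl⟩, hc⟩ := hcm
  obtain ⟨a₁, b₂, ha₁, ha₁x, hb₂c, hb₂, hup⟩ := exists_upper_sides hF hθl0 hθu0 hdl hdu hθl hh hβ0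
    hβ hc.le hc1 hx₀.1.1
  obtain ⟨b₁, a₂, hb₁x, hb₁, ha₂, ha₂c, hlow⟩ := exists_lower_sides hF hθl0 hθu0 hdl hdu hh hβ0
    hθu hβ' hc.le hc1 hx₀.1.2
  have hx₀u : x₀.2 < c * du := (div_lt_iff₀ hdu).1 hcdu
  have hx₀l : c * dl < x₀.2 := (div_lt_iff_of_neg hdl).1 hcdl
  let S : Set (ℝ × ℝ) :=
    {p | a₁ ≤ p.1 ∧ p.1 ≤ b₁ ∧ a₂ ≤ p.2 ∧ p.2 ≤ b₂ ∧ tilt θu du p ≤ c ∧ tilt θl dl p ≤ c}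
  have hR : Icc (a₁, a₂) (b₁, b₂) ⊆ Ioo θl θu ×ˢ Ioo dl du := fun p hp =>
    ⟨⟨ha₁.trans_le hp.1.1, hp.2.1.trans_lt hb₁⟩, ha₂.trans_le hp.1.2, hp.2.2.trans_lt hb₂⟩
  have hSbox : S ⊆ Icc (a₁, a₂) (b₁, b₂) := fun p hp =>
    ⟨⟨hp.1, hp.2.2.1⟩, hp.2.1, hp.2.2.2.1⟩
  have hSc : IsClosed S := by
    have hu := continuous_tilt θu du
    have hl := continuous_tilt θl dl
    exact (isClosed_le continuous_const continuous_fst).inter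
      ((isClosed_le continuous_fst continuous_const).inter
      ((isClosed_le continuous_const continuous_snd).inter
      ((isClosed_le continuous_snd continuous_const).inter
      ((isClosed_le hu continuous_const).inter (isClosed_le hl continuous_const)))))
  refine ⟨(a₁, a₂), (b₁, b₂), S,
    ⟨ha₁x, hb₁x, by linarith, by linarith, hcu.le, hcl.le⟩, hSc, hSbox, hR,
    fun z hz hder hz0 => forall_mem_of_eventually hSc hz hz0 fun t ht hin => ?_⟩
  have hzt : z t ∈ S := hin t ⟨ht, le_rfl⟩
  have hd := hder t ht hzt
  have hd1 : HasDerivWithinAt (fun r => (z r).1) (closedLoop F 1 β 1 (z t)).1 (Ici 0) t := hd.fst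
  have hd2 : HasDerivWithinAt (fun r => (z r).2) (closedLoop F 1 β 1 (z t)).2 (Ici 0) t := hd.snd
  have hzR := hR (hSbox hzt)
  obtain ⟨h1, h2, h3, h4, h5, h6⟩ := hzt
  obtain ⟨u1, u2, u3⟩ := hup (z t) hzR h4 h5
  obtain ⟨l1, l2, l3⟩ := hlow (z t) hzR h3 h6
  filter_upwards [eventually_le_of_deriv_neg ht hd1.neg (neg_le_neg h1)
      fun e => neg_lt_zero.2 (u1 (neg_injective e)),
    eventually_le_of_deriv_neg ht hd1 h2 l1,
    eventually_le_of_deriv_neg ht hd2.neg (neg_le_neg h3)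
      fun e => neg_lt_zero.2 (l2 (neg_injective e)),
    eventually_le_of_deriv_neg ht hd2 h4 u2,
    eventually_le_of_deriv_neg ht (hasDerivWithinAt_tilt θu du hd) h5 u3,
    eventually_le_of_deriv_neg ht (hasDerivWithinAt_tilt θl dl hd) h6 l3] with s e1 e2 e3 e4 e5 e6
  exact ⟨neg_le_neg_iff.1 e1, e2, neg_le_neg_iff.1 e3, e4, e5, e6⟩

end Hexagon

/-! ### The closed loop -/

lemma exists_lipschitzOnWith_closedLoop {F : ℝ × ℝ → ℝ} {θl θu dl du β : ℝ}
    (hF : IsScoreFunction F θl θu dl du) {a b : ℝ × ℝ}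
    (hab : Icc a b ⊆ Ioo θl θu ×ˢ Ioo dl du) :
    ∃ K, LipschitzOnWith K (closedLoop F 1 β 1) (Icc a b) := by
  have hF' := hF.contDiffOn.mono hab
  have h : ContDiffOn ℝ 1 (closedLoop F 1 β 1) (Icc a b) := by
    unfold closedLoop
    exact (contDiffOn_const.mul hF').prodMk ((contDiffOn_const.mul
      ((contDiffOn_const.mul (hF'.pow 2)).exp)).mul contDiffOn_fst.sin)
  exact h.exists_lipschitzOnWith one_ne_zero (convex_Icc a b) isCompact_Icc

end ScoreControl

open ScoreControl in
theorem mainTheorem3 (F : ℝ × ℝ → ℝ) (θl θu dl du : ℝ)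
    (hθl : -Real.pi < θl) (hθl0 : θl < 0) (hθu0 : 0 < θu) (hθu : θu < Real.pi)
    (hdl : dl < 0) (hdu : 0 < du)
    (hF : ScoreControl.IsScoreFunction F θl θu dl du)
    (hh : ScoreControl.ZeroCurveSpans F θl θu dl du) :
    ∃ α β γ : ℝ, 0 < α ∧ 0 < β ∧ 0 < γ ∧
      -- each initial state in `X₀` has exactly one trajectory, and it tends to the origin
      (∀ x₀ ∈ ScoreControl.X0 θl θu dl du,
        ∃ x : ℝ → ℝ × ℝ, ScoreControl.IsTrajectory F α β γ x₀ x ∧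
          (∀ y : ℝ → ℝ × ℝ, ScoreControl.IsTrajectory F α β γ x₀ y → EqOn y x (Ici 0)) ∧
          Tendsto x atTop (𝓝 (0, 0))) ∧
      -- the origin is Lyapunov stable
      (∀ ε > 0, ∃ δ > 0, ∀ x₀ : ℝ × ℝ, ‖x₀‖ < δ →
        ∀ x : ℝ → ℝ × ℝ, ScoreControl.IsTrajectory F α β γ x₀ x → ∀ t ≥ 0, ‖x t‖ < ε) := by
  obtain ⟨β₁, hβ₁, hs₁⟩ := exists_slowGain hF hθl0 hθu0 hdl hdu
  obtain ⟨β₂, hβ₂, hs₂⟩ := exists_slowGain hF.reflect (neg_lt_zero.2 hθu0)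
    (neg_pos.2 hθl0) (neg_lt_zero.2 hdu) (neg_pos.2 hdl)
  have hβ := lt_min hβ₁ hβ₂
  refine ⟨1, min β₁ β₂, 1, one_pos, hβ, one_pos, fun x₀ hx₀ => ?_,
    lyapunov_stable hF hθl0 hθu0 hdl hdu hβ hθl hθu⟩
  obtain ⟨hR₀, hu, hl⟩ := tilt_lt_one_of_mem_X0 hθl0 hθu0 hdl hdu hx₀
  obtain ⟨a, b, S, hx₀S, hSc, hSab, habR, hinv⟩ := exists_invariant_hexagon hF hθl0 hθu0 hdl hdu
    hθl hh hβ (hs₁.mono hdu (min_le_left _ _)) hθu (hs₂.mono (neg_pos.2 hdl) (min_le_right _ _))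
    hR₀ hu hl
  obtain ⟨K, hK⟩ := exists_lipschitzOnWith_closedLoop (β := min β₁ β₂) hF habR
  have hSR : S ⊆ Ioo θl θu ×ˢ Ioo dl du := hSab.trans habR
  have hKS := hK.mono hSab
  obtain ⟨x, hx0, hx, hxS⟩ := exists_integralCurve_mem_of_invariant hK hSab hinv hx₀S
  refine ⟨x, ⟨hx0, hx⟩, fun y hy => ?_, ?_⟩
  · have hyS := hinv y (fun t ht => (hy.2 t ht).continuousWithinAt) (fun t ht _ => hy.2 t ht)
      (hy.1.symm ▸ hx₀S)
    exact eqOn_of_integralCurves hKS hy.2 hyS hx hxS (hy.1.trans hx0.symm)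
  · refine tendsto_of_lyapunov (isCompact_Icc.of_isClosed_subset hSc hSab) hKS
      ((continuousOn_energy hF hθl0 hθu0 hdl hdu (β := min β₁ β₂)).mono hSR)
      (fun z hz hzS => antitoneOn_energy hF hθl0 hθu0 hdl hdu hβ hθl hθu (convex_Ici 0) hz
        fun t ht => hSR (hzS t ht)) (fun p hp hne => ?_) hx hxS
    obtain ⟨z, hz0, hz, hzS⟩ := exists_integralCurve_mem_of_invariant hK hSab hinv hp
    obtain ⟨s, hs, hlt⟩ := exists_energy_lt hF hθl0 hθu0 hdl hdu hβ hθl hθu hz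
      (fun t ht => hSR (hzS t ht)) (hz0 ▸ hne)
    exact ⟨z, hz0, hz, hzS, s, hs, hz0 ▸ hlt⟩
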